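/- For $n\ge 1$ let $\mathrm{C}^{n-1}Z=\operatorname{diag}(1,\dots,1,-1)$ be the multi-controlled-$Z$ gate on $n$ qubits, $|\mathrm{C}^{n-1}Z\rangle=\mathrm{C}^{n-1}Z\,|+\rangle^{\otimes n}$, and $\Phi_n$ the projector onto this state. Let $\mathrm{STAB}_n$ be the convex hull of the (projectors onto) pure $n$-qubit stabilizer states, and $$\mathcal R(\rho)=\min\{2a+1:\ \rho=(a+1)\sigma-a\tau,\ a\ge 0,\ \sigma,\tau\in\mathrm{STAB}_n\}$$ the robustness of magic. For $\lambda\in[0,1]$ let $\mathcal E_\lambda(\sigma)=(1-\lambda)\sigma+\lambda\operatorname{Tr}(\sigma)\,\mathbb I/2$ be the single-qubit depolarizing channel; for $\epsilon\ge0$ the $\epsilon$-magic noise threshold of an $n$-qubit state $\rho$ is $$\lambda^*_\epsilon(\rho)=\inf\{\lambda\in[0,1]:\ \mathcal R(\mathcal E_\lambda^{\otimes n}(\rho))\le 1+\epsilon\}.$$ Finally let $\mathcal D(\rho)=2^{-n}\sum_{P}|\operatorname{Tr}(P\rho)|$, the sum being over the $4^n$ $n$-qubit Pauli operators with phase $+1$.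 Then: 1. For every fixed $0<\epsilon<2$, $\lambda^*_\epsilon(\Phi_n)=\Theta(1/n)$ as $n\to\infty$. More generally, this holds for every fixed $\epsilon>0$ such that $1+\epsilon<\liminf_{n\to\infty}\mathcal R(\Phi_n)$. 2. For every fixed $\epsilon>0$, $\lambda^*_\epsilon(\Phi_n)=O(1/n)$. 3. For all $n\ge1$ and $\lambda\in[0,1]$, $$\mathcal D(\mathcal E_\lambda^{\otimes n}(\Phi_n))\ \le\ \mathcal R(\mathcal E_\lambda^{\otimes n}(\Phi_n))\ \le\ 1+4(1-\lambda/2)^n .$$ 4. For all $n\ge2$ and $\lambda\in[0,1]$, $$\mathcal D(\mathcal E_\lambda^{\otimes n}(\Phi_n))=2\Big(1-\frac{3\lambda}{4}\Big)^n+\Big(1-\frac{\lambda}{2}\Big)^n+\frac{8}{4^n}-10\Big(\frac12-\frac{\lambda}{4}\Big)^n .$$ -/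

import Mathlib

open Filter Asymptotics

noncomputable section

namespace QMagic

/-- Operators on the space of `n` qubits; the computational basis is indexed by bit strings. -/
abbrev Op (n : ℕ) := Matrix (Fin n → Fin 2) (Fin n → Fin 2) ℂ

/-- Vectors of the space of `n` qubits, in the computational basis. -/
abbrev Ket (n : ℕ) := (Fin n → Fin 2) → ℂ

/-- The single-qubit Pauli matrices `I, X, Y, Z`. -/
def pauli1 : Fin 4 → Matrix (Fin 2) (Fin 2) ℂ :=
  ![1, !![0, 1; 1, 0], !![0, -Complex.I; Complex.I, 0], !![1, 0; 0, -1]]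

/-- The `n`-qubit Pauli operator (with phase `+1`) that is the tensor product of the `pauli1 (p i)`. -/
def pauliString {n : ℕ} (p : Fin n → Fin 4) : Op n :=
  Matrix.of fun x y => ∏ i, pauli1 (p i) (x i) (y i)

/-- The projector `|ψ⟩⟨ψ|`. -/
def proj {n : ℕ} (ψ : Ket n) : Op n := Matrix.vecMulVec ψ (star ψ)

/-- A pure stabilizer state: a unit vector that is fixed by `2 ^ n` elements of the Pauli group.
Only the elements `± P` with `P` a Pauli string can fix a nonzero vector, and at most one of
`P` and `-P` does, so it suffices to count the strings `P` with `P ψ = ψ` or `P ψ = -ψ`. -/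
def IsPureStabilizer {n : ℕ} (ψ : Ket n) : Prop :=
  star ψ ⬝ᵥ ψ = 1 ∧
    {p : Fin n → Fin 4 | (pauliString p).mulVec ψ = ψ ∨ (pauliString p).mulVec ψ = -ψ}.ncard = 2 ^ n

/-- The set `STAB_n` of `n`-qubit stabilizer states: the convex hull of the pure ones. -/
def STAB (n : ℕ) : Set (Op n) :=
  convexHull ℝ {ρ : Op n | ∃ ψ : Ket n, IsPureStabilizer ψ ∧ ρ = proj ψ}

/-- The robustness of magic. -/
def robustness {n : ℕ} (ρ : Op n) : ℝ :=
  sInf {r : ℝ | ∃ a : ℝ, 0 ≤ a ∧ r = 2 * a + 1 ∧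
    ∃ σ ∈ STAB n, ∃ τ ∈ STAB n, ρ = (a + 1) • σ - a • τ}

/-- The Pauli-spectrum quantity `𝒟(ρ) = 2⁻ⁿ ∑_P |Tr(P ρ)|`. -/
def pauliNorm {n : ℕ} (ρ : Op n) : ℝ :=
  (1 / 2 ^ n) * ∑ p : Fin n → Fin 4, ‖(pauliString p * ρ).trace‖

/-- The single-qubit depolarizing channel `σ ↦ (1 - l) σ + l Tr(σ) I / 2`. -/
def depol (l : ℝ) (σ : Matrix (Fin 2) (Fin 2) ℂ) : Matrix (Fin 2) (Fin 2) ℂ :=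
  (1 - l) • σ + l • (σ.trace • ((1 / 2 : ℂ) • (1 : Matrix (Fin 2) (Fin 2) ℂ)))

/-- The `n`-fold tensor power of a (linear) map `E` on single-qubit operators: the linear map sending
`⨂ i, |u i⟩⟨v i|` to `⨂ i, E (|u i⟩⟨v i|)`. -/
def tensorPower (n : ℕ) (E : Matrix (Fin 2) (Fin 2) ℂ → Matrix (Fin 2) (Fin 2) ℂ) (ρ : Op n) : Op n :=
  Matrix.of fun x y => ∑ u : Fin n → Fin 2, ∑ v : Fin n → Fin 2,
    (∏ i, E (Matrix.single (u i) (v i) 1) (x i) (y i)) * ρ u v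

/-- Independent depolarizing noise of rate `l` on `n` qubits. -/
def noise (n : ℕ) (l : ℝ) (ρ : Op n) : Op n := tensorPower n (depol l) ρ

/-- The `ε`-magic noise threshold; the noise rates are the numbers in `[0, 1]`. -/
def threshold {n : ℕ} (ε : ℝ) (ρ : Op n) : ℝ :=
  sInf {l : ℝ | l ∈ Set.Icc (0 : ℝ) 1 ∧ robustness (noise n l ρ) ≤ 1 + ε}

/-- The multi-controlled-`Z` gate `diag(1, …, 1, -1)` on `n` qubits. -/
def multiCZ (n : ℕ) : Op n :=
  Matrix.diagonal fun x => if ∀ i, x i = 1 then -1 else 1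

/-- The state vector `|+ⁿ⟩`. -/
def plusKet (n : ℕ) : Ket n := fun _ => ((1 / Real.sqrt (2 ^ n) : ℝ) : ℂ)

/-- `Φ_n`, the density operator of the state `C^{n-1}Z |+ⁿ⟩`. -/
def czState (n : ℕ) : Op n := proj ((multiCZ n).mulVec (plusKet n))

end QMagic

end

open QMagic

/-!
The proof rests on two estimates for the robustness of the noisy state, together with a stability
property under noise.

*Lower bound.* The Pauli norm `𝒟` is a seminorm, and equals `1` on pure stabilizer states: by
Parseval's identity the squared Pauli coefficients of a pure state sum to `2 ^ n`, and the `2 ^ n`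
stabilizers already exhaust this sum (`pauliNorm_proj`). Hence `𝒟 ≤ ℛ`
(`pauliNorm_le_robustness`). The same identity shows that a unit vector each Pauli string of which
is either a stabilizer up to sign or has expectation zero is a stabilizer state
(`isPureStabilizer_of_forall`), which avoids counting stabilizers in the examples.

*Upper bound.* In the computational basis `Φ_n` differs from the projector onto `|+ⁿ⟩` by a real
symmetric matrix with zero diagonal, supported on the row and the column of `|1…1⟩`. The noise
preserves this shape and multiplies the total absolute value of the entries coming from `|u⟩⟨v|` by
`1 - l` for each site where `u` and `v` differ; summed over `u` with `v = 1…1` this gives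
`(2 - l) ^ n` (`sum_abs_noiseReal_czDiff_le`). Each `|x⟩⟨y| + |y⟩⟨x|` is the difference of the
projectors onto the stabilizer states `(|x⟩ ± |y⟩) / √2`, so this matrix is at most
`2 (1 - l / 2) ^ n` times a difference of two elements of `STAB` (`exists_eq_smul_sub_of_isSymm`),
and `ℛ ≤ 1 + 4 (1 - l / 2) ^ n` follows (`hasStabDecomp_noise_czState`).

*Formula for `𝒟`.* The absolute Pauli coefficients of `Φ_n` are a combination of five functions
that are products over the sites (`two_pow_mul_norm_trace_czState`), and so is the damping by the
noise. Sums of such functions over all Pauli strings are `n`-th powers.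

*Thresholds.* The upper bound on `ℛ` is at most `1 + ε` at a rate `c / n`, so the threshold is
`O(1 / n)`. Conversely, the noise leaves the state alone with probability
`q = (1 - 3 l / 4) ^ n ≥ 1 - 3 n l / 4` and otherwise applies Pauli operators, which preserve
`STAB`; this gives `ℛ(noisy) ≥ (2 q - 1) ℛ(Φ_n)` (`mul_robustness_le_robustness_noise`). So if
`ℛ(Φ_n)` stays above a level larger than `1 + ε`, rates below a small multiple of `1 / n` are not
enough. As `𝒟(Φ_n)` tends to `3`, this applies to all `ε < 2`.
-/

open QMagic

namespace QMagic

open Matrix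

/-! ### Tensor products and Pauli strings -/

/-- Distributivity: a sum over strings of a product over the sites factorizes. -/
theorem sum_prod_pi {ι κ R : Type*} [Fintype ι] [DecidableEq ι] [Fintype κ] [CommSemiring R]
    (f : ι → κ → R) : ∑ p : ι → κ, ∏ i, f i (p i) = ∏ i, ∑ j, f i j := by
  rw [Finset.prod_univ_sum, Fintype.piFinset_univ]

theorem sum_sum_prod_pi {ι κ κ' R : Type*} [Fintype ι] [DecidableEq ι] [Fintype κ] [Fintype κ']
    [CommSemiring R] (f : ι → κ → κ' → R) :
    ∑ x : ι → κ, ∑ y : ι → κ', ∏ i, f i (x i) (y i) = ∏ i, ∑ a, ∑ b, f i a b := by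
  rw [← sum_prod_pi]
  exact Finset.sum_congr rfl fun x _ => sum_prod_pi fun i => f i (x i)

theorem sum_sum_comm_sum_sum {κ R : Type*} [Fintype κ] [AddCommMonoid R]
    (f : κ → κ → κ → κ → R) :
    ∑ x, ∑ y, ∑ u, ∑ v, f x y u v = ∑ u, ∑ v, ∑ x, ∑ y, f x y u v := by
  have h := Finset.sum_comm (s := Finset.univ) (t := Finset.univ)
    (f := fun z w : κ × κ => f z.1 z.2 w.1 w.2)
  simpa only [Fintype.sum_prod_type] using h

/-- The product of the Kronecker deltas of the coordinates. -/
theorem prod_ite_eq_apply {ι κ R : Type*} [Fintype ι] [DecidableEq κ] [CommSemiring R]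
    (x y : ι → κ) (c : R) :
    ∏ i, (if x i = y i then c else 0) = if x = y then c ^ Fintype.card ι else 0 := by
  split_ifs with h
  · simp [h]
  · obtain ⟨i, hi⟩ := Function.ne_iff.mp h
    exact Finset.prod_eq_zero (Finset.mem_univ i) (if_neg hi)

/-- The tensor product `A 0 ⊗ ⋯ ⊗ A (n - 1)` of single-qubit operators. -/
def tensor {n : ℕ} (A : Fin n → Matrix (Fin 2) (Fin 2) ℂ) : Op n :=
  Matrix.of fun x y => ∏ i, A i (x i) (y i)

theorem pauliString_eq_tensor {n : ℕ} (p : Fin n → Fin 4) :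
    pauliString p = tensor fun i => pauli1 (p i) := rfl

theorem tensor_apply {n : ℕ} (A : Fin n → Matrix (Fin 2) (Fin 2) ℂ) (x y : Fin n → Fin 2) :
    tensor A x y = ∏ i, A i (x i) (y i) := rfl

theorem pauliString_apply {n : ℕ} (p : Fin n → Fin 4) (x y : Fin n → Fin 2) :
    pauliString p x y = ∏ i, pauli1 (p i) (x i) (y i) := rfl

theorem tensor_mul {n : ℕ} (A B : Fin n → Matrix (Fin 2) (Fin 2) ℂ) :
    tensor A * tensor B = tensor fun i => A i * B i := by
  ext x y
  simp only [Matrix.mul_apply, tensor_apply, ← Finset.prod_mul_distrib]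
  exact sum_prod_pi fun i j => A i (x i) j * B i j (y i)

theorem tensor_one {n : ℕ} : tensor (fun _ : Fin n => 1) = 1 := by
  ext x y
  simp only [tensor_apply, Matrix.one_apply]
  rw [prod_ite_eq_apply]
  simp

theorem tensor_smul {n : ℕ} (c : Fin n → ℂ) (A : Fin n → Matrix (Fin 2) (Fin 2) ℂ) :
    tensor (fun i => c i • A i) = (∏ i, c i) • tensor A := by
  ext x y
  simp [tensor_apply, Finset.prod_mul_distrib]

theorem tensor_conjTranspose {n : ℕ} (A : Fin n → Matrix (Fin 2) (Fin 2) ℂ) :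
    (tensor A)ᴴ = tensor fun i => (A i)ᴴ := by
  ext x y
  simp [tensor_apply, Matrix.conjTranspose_apply]

theorem pauli1_conjTranspose (a : Fin 4) : (pauli1 a)ᴴ = pauli1 a := by
  fin_cases a <;> ext i j <;> fin_cases i <;> fin_cases j <;> simp [pauli1]

theorem pauli1_mul_self (a : Fin 4) : pauli1 a * pauli1 a = 1 := by
  fin_cases a <;> ext i j <;> fin_cases i <;> fin_cases j <;> simp [pauli1, Matrix.mul_apply]

theorem pauli1_mul_comm_or (a b : Fin 4) :
    pauli1 a * pauli1 b = pauli1 b * pauli1 a ∨ pauli1 a * pauli1 b = -(pauli1 b * pauli1 a) := by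
  fin_cases a <;> fin_cases b <;>
    first
    | (left; ext i j; fin_cases i <;> fin_cases j <;> simp [pauli1, Matrix.mul_apply]; done)
    | (right; ext i j; fin_cases i <;> fin_cases j <;> simp [pauli1, Matrix.mul_apply])

theorem pauliString_conjTranspose {n : ℕ} (p : Fin n → Fin 4) :
    (pauliString p)ᴴ = pauliString p := by
  simp [pauliString_eq_tensor, tensor_conjTranspose, pauli1_conjTranspose]

theorem pauliString_mul_self {n : ℕ} (p : Fin n → Fin 4) :
    pauliString p * pauliString p = 1 := by
  simp [pauliString_eq_tensor, tensor_mul, pauli1_mul_self, tensor_one]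

theorem pauliString_zero {n : ℕ} : pauliString (0 : Fin n → Fin 4) = 1 := by
  rw [pauliString_eq_tensor, ← tensor_one]
  rfl

theorem prod_eq_one_or_neg_one {ι : Type*} [Fintype ι] (s : ι → ℂ)
    (hs : ∀ i, s i = 1 ∨ s i = -1) : ∏ i, s i = 1 ∨ ∏ i, s i = -1 := by
  refine Finset.prod_induction s (fun z => z = 1 ∨ z = -1) ?_ (Or.inl rfl) fun i _ => hs i
  rintro a b (rfl | rfl) (rfl | rfl) <;> simp

/-- Two Pauli strings either commute or anticommute. -/
theorem pauliString_mul_comm_or {n : ℕ} (p q : Fin n → Fin 4) :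
    pauliString p * pauliString q = pauliString q * pauliString p ∨
      pauliString p * pauliString q = -(pauliString q * pauliString p) := by
  have h : ∀ i, ∃ s : ℂ, (s = 1 ∨ s = -1) ∧
      pauli1 (p i) * pauli1 (q i) = s • (pauli1 (q i) * pauli1 (p i)) := fun i => by
    rcases pauli1_mul_comm_or (p i) (q i) with h | h
    · exact ⟨1, Or.inl rfl, by simpa using h⟩
    · exact ⟨-1, Or.inr rfl, by simpa using h⟩
  choose s hs h using h
  have key : pauliString p * pauliString q = (∏ i, s i) • (pauliString q * pauliString p) := by
    simp only [pauliString_eq_tensor, tensor_mul, h, tensor_smul]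
  rcases prod_eq_one_or_neg_one s hs with h1 | h1 <;> simp [key, h1]

/-! ### The Pauli expansion and pure stabilizer states -/

theorem sum_pauli1_mul_star (x y u v : Fin 2) :
    ∑ a, pauli1 a x y * star (pauli1 a u v) = (if x = u then 2 else 0) * if y = v then 1 else 0 := by
  fin_cases x <;> fin_cases y <;> fin_cases u <;> fin_cases v <;>
    simp [Fin.sum_univ_four, pauli1] <;> norm_num

theorem sum_pauliString_mul_star {n : ℕ} (x y u v : Fin n → Fin 2) :
    ∑ p, pauliString p x y * star (pauliString p u v) =
      if x = u then (if y = v then 2 ^ n else 0) else 0 := by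
  simp only [pauliString_apply, star_prod, ← Finset.prod_mul_distrib]
  rw [sum_prod_pi fun i a => pauli1 a (x i) (y i) * star (pauli1 a (u i) (v i))]
  simp only [sum_pauli1_mul_star, Finset.prod_mul_distrib]
  rw [prod_ite_eq_apply, prod_ite_eq_apply]
  split_ifs <;> simp

theorem trace_mul_eq_sum {n : ℕ} (A B : Op n) : (A * B).trace = ∑ x, ∑ y, A x y * B y x := by
  simp [Matrix.trace, Matrix.mul_apply]

/-- Parseval's identity for the Pauli strings, which are orthogonal with squared norm `2 ^ n`. -/
theorem sum_norm_sq_trace {n : ℕ} (ρ : Op n) :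
    ∑ p, ‖(pauliString p * ρ).trace‖ ^ 2 = 2 ^ n * ∑ x, ∑ y, ‖ρ x y‖ ^ 2 := by
  have hz : ∀ z : ℂ, ((‖z‖ ^ 2 : ℝ) : ℂ) = z * star z := fun z => by
    rw [Complex.star_def, Complex.mul_conj, Complex.normSq_eq_norm_sq]
  have h : ∀ p : Fin n → Fin 4, ((‖(pauliString p * ρ).trace‖ ^ 2 : ℝ) : ℂ) =
      ∑ x, ∑ y, ∑ u, ∑ v, (pauliString p x y * star (pauliString p u v)) *
        (ρ y x * star (ρ v u)) := fun p => by
    rw [hz, trace_mul_eq_sum]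
    simp only [star_sum, star_mul']
    rw [Finset.sum_mul]
    refine Finset.sum_congr rfl fun x _ => ?_
    rw [Finset.sum_mul]
    refine Finset.sum_congr rfl fun y _ => ?_
    rw [Finset.mul_sum]
    refine Finset.sum_congr rfl fun u _ => ?_
    rw [Finset.mul_sum]
    exact Finset.sum_congr rfl fun v _ => mul_mul_mul_comm _ _ _ _
  apply Complex.ofReal_injective
  rw [Complex.ofReal_sum]
  simp only [h]
  rw [Finset.sum_comm]
  have h2 : ∀ x : Fin n → Fin 2, ∑ p : Fin n → Fin 4, ∑ y, ∑ u, ∑ v,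
      (pauliString p x y * star (pauliString p u v)) * (ρ y x * star (ρ v u)) =
      ∑ y, 2 ^ n * (ρ y x * star (ρ y x)) := fun x => by
    rw [Finset.sum_comm]
    refine Finset.sum_congr rfl fun y _ => ?_
    rw [Finset.sum_comm]
    simp_rw [Finset.sum_comm (s := (Finset.univ : Finset (Fin n → Fin 4))), ← Finset.sum_mul,
      sum_pauliString_mul_star]
    simp
  simp only [h2, ← Finset.mul_sum, ← hz]
  rw [Finset.sum_comm]
  push_cast
  rfl

theorem trace_mul_proj {n : ℕ} (A : Op n) (ψ : Ket n) :
    (A * proj ψ).trace = star ψ ⬝ᵥ A *ᵥ ψ := by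
  rw [proj, Matrix.mul_vecMulVec, Matrix.trace_vecMulVec, dotProduct_comm]

theorem sum_norm_sq_eq_one {n : ℕ} {ψ : Ket n} (h : star ψ ⬝ᵥ ψ = 1) : ∑ x, ‖ψ x‖ ^ 2 = 1 := by
  apply Complex.ofReal_injective
  rw [Complex.ofReal_one, ← h, Complex.ofReal_sum]
  refine Finset.sum_congr rfl fun x _ => ?_
  rw [Pi.star_apply, Complex.star_def, mul_comm, Complex.mul_conj, Complex.normSq_eq_norm_sq]

theorem sum_norm_sq_trace_proj {n : ℕ} {ψ : Ket n} (h : star ψ ⬝ᵥ ψ = 1) :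
    ∑ p, ‖(pauliString p * proj ψ).trace‖ ^ 2 = 2 ^ n := by
  rw [sum_norm_sq_trace]
  simp only [proj, Matrix.vecMulVec_apply, Pi.star_apply, norm_mul, norm_star, mul_pow,
    ← Finset.mul_sum, ← Finset.sum_mul, sum_norm_sq_eq_one h]
  simp

theorem norm_trace_proj_of_eigenvector {n : ℕ} {ψ : Ket n} (h : star ψ ⬝ᵥ ψ = 1)
    {p : Fin n → Fin 4} (hp : pauliString p *ᵥ ψ = ψ ∨ pauliString p *ᵥ ψ = -ψ) :
    ‖(pauliString p * proj ψ).trace‖ = 1 := by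
  rw [trace_mul_proj]
  rcases hp with hp | hp <;> simp [hp, h]

/-- A unit vector is a stabilizer state as soon as every Pauli string either fixes it up to sign or
has expectation zero: by Parseval's identity the strings of the first kind then number `2 ^ n`. -/
theorem isPureStabilizer_of_forall {n : ℕ} {ψ : Ket n} (h : star ψ ⬝ᵥ ψ = 1)
    (hp : ∀ p : Fin n → Fin 4, (pauliString p *ᵥ ψ = ψ ∨ pauliString p *ᵥ ψ = -ψ) ∨
      star ψ ⬝ᵥ pauliString p *ᵥ ψ = 0) : IsPureStabilizer ψ := by
  classical
  refine ⟨h, ?_⟩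
  have key := sum_norm_sq_trace_proj h
  have h1 : ∀ p : Fin n → Fin 4, ‖(pauliString p * proj ψ).trace‖ ^ 2 =
      if pauliString p *ᵥ ψ = ψ ∨ pauliString p *ᵥ ψ = -ψ then 1 else 0 := fun p => by
    split_ifs with hs
    · simp [norm_trace_proj_of_eigenvector h hs]
    · rw [trace_mul_proj, (hp p).resolve_left hs]
      simp
  simp only [h1, Finset.sum_boole] at key
  rw [Set.ncard_eq_toFinset_card', Set.toFinset_ofPred]
  exact_mod_cast key

theorem pauliNorm_proj {n : ℕ} {ψ : Ket n} (h : IsPureStabilizer ψ) : pauliNorm (proj ψ) = 1 := by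
  classical
  obtain ⟨h, hcard⟩ := h
  rw [Set.ncard_eq_toFinset_card', Set.toFinset_ofPred] at hcard
  have key := sum_norm_sq_trace_proj h
  rw [← Finset.sum_filter_add_sum_filter_not _
    (fun p : Fin n → Fin 4 => pauliString p *ᵥ ψ = ψ ∨ pauliString p *ᵥ ψ = -ψ)] at key
  have h1 : ∀ k : ℕ, ∑ p with pauliString p *ᵥ ψ = ψ ∨ pauliString p *ᵥ ψ = -ψ,
      ‖(pauliString p * proj ψ).trace‖ ^ k = 2 ^ n := fun k => by
    rw [Finset.sum_congr rfl (g := fun _ => (1 : ℝ)) fun p hp => by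
      rw [norm_trace_proj_of_eigenvector h (Finset.mem_filter.mp hp).2, one_pow]]
    rw [Finset.sum_const, hcard]
    simp
  rw [h1, add_eq_left, Finset.sum_eq_zero_iff_of_nonneg fun _ _ => by positivity] at key
  have h2 := h1 1
  simp only [pow_one] at h2
  rw [pauliNorm, ← Finset.sum_filter_add_sum_filter_not _
    (fun p : Fin n → Fin 4 => pauliString p *ᵥ ψ = ψ ∨ pauliString p *ᵥ ψ = -ψ), h2,
    Finset.sum_eq_zero fun p hp => pow_eq_zero_iff two_ne_zero |>.mp (key p hp)]
  simp

/-! ### Examples of pure stabilizer states -/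

theorem isPureStabilizer_plusKet (n : ℕ) : IsPureStabilizer (plusKet n) := by
  have hc : ((1 / Real.sqrt (2 ^ n) : ℝ) : ℂ) * ((1 / Real.sqrt (2 ^ n) : ℝ) : ℂ) * 2 ^ n = 1 := by
    have h : (1 / Real.sqrt (2 ^ n)) * (1 / Real.sqrt (2 ^ n)) * 2 ^ n = 1 := by
      rw [div_mul_div_comm, Real.mul_self_sqrt (by positivity)]
      field_simp
    exact_mod_cast congrArg Complex.ofReal h
  have hplus : star (plusKet n) = plusKet n := by
    funext x
    simp [plusKet]
  have hP : ∀ p x, (pauliString p *ᵥ plusKet n) x =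
      (∏ i, ∑ b, pauli1 (p i) (x i) b) * ((1 / Real.sqrt (2 ^ n) : ℝ) : ℂ) := fun p x => by
    simp only [Matrix.mulVec, dotProduct, plusKet, ← Finset.sum_mul, pauliString_apply]
    rw [sum_prod_pi fun i b => pauli1 (p i) (x i) b]
  refine isPureStabilizer_of_forall ?_ fun p => ?_
  · rw [hplus]
    simp only [dotProduct, plusKet]
    rw [Finset.sum_const, nsmul_eq_mul, ← hc, mul_comm]
    simp
  · by_cases hp : ∀ i, p i = 0 ∨ p i = 1
    · -- The rows of `I` and `X` sum to `1`.
      refine Or.inl (Or.inl (funext fun x => ?_))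
      rw [hP, Finset.prod_eq_one, one_mul, plusKet]
      intro i _
      generalize x i = a
      rcases hp i with h | h <;> fin_cases a <;> simp [h, pauli1]
    · -- The entries of `Y` sum to `0`, and so do those of `Z`.
      right
      push Not at hp
      obtain ⟨i, hi⟩ := hp
      simp only [hplus, dotProduct, hP]
      simp only [plusKet, ← Finset.mul_sum, ← Finset.sum_mul]
      rw [sum_prod_pi fun i a => ∑ b, pauli1 (p i) a b, Finset.prod_eq_zero (Finset.mem_univ i)]
      · simp
      · generalize p i = a at hi
        fin_cases a <;> simp_all [pauli1]

/-- A Pauli string permutes the computational basis by a translation, up to fourth roots of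
unity. -/
theorem exists_pauliString_mulVec_single {n : ℕ} (p : Fin n → Fin 4) :
    ∃ (f : Fin n → Fin 2) (ph : Ket n),
      (∀ y, pauliString p *ᵥ Pi.single y 1 = ph y • Pi.single (y + f) 1) ∧
      ∀ y, ph y ^ 2 = 1 ∨ ph y ^ 2 = -1 := by
  have h1 : ∀ a : Fin 4, ∃ (f : Fin 2) (ph : Fin 2 → ℂ),
      (∀ x y, pauli1 a x y = if x = y + f then ph y else 0) ∧ ∀ y, ph y ^ 2 = 1 ∨ ph y ^ 2 = -1 := by
    intro a
    fin_cases a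
    · refine ⟨0, ![1, 1], fun x y => ?_, fun y => ?_⟩
      · fin_cases x <;> fin_cases y <;> simp [pauli1]
      · fin_cases y <;> simp
    · refine ⟨1, ![1, 1], fun x y => ?_, fun y => ?_⟩
      · fin_cases x <;> fin_cases y <;> simp [pauli1]
      · fin_cases y <;> simp
    · refine ⟨1, ![Complex.I, -Complex.I], fun x y => ?_, fun y => ?_⟩
      · fin_cases x <;> fin_cases y <;> simp [pauli1]
      · fin_cases y <;> simp
    · refine ⟨0, ![1, -1], fun x y => ?_, fun y => ?_⟩
      · fin_cases x <;> fin_cases y <;> simp [pauli1]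
      · fin_cases y <;> simp
  choose f ph h1 h2 using h1
  refine ⟨fun i => f (p i), fun y => ∏ i, ph (p i) (y i), fun y => ?_, fun y => ?_⟩
  · funext x
    simp only [Matrix.mulVec_single_one, Matrix.col_apply, Pi.smul_apply, Pi.single_apply,
      smul_eq_mul, mul_ite, mul_one, mul_zero, pauliString_apply, h1]
    split_ifs with h
    · exact Finset.prod_congr rfl fun i _ => if_pos (congrFun h i)
    · obtain ⟨i, hi⟩ := Function.ne_iff.mp h
      exact Finset.prod_eq_zero (Finset.mem_univ i) (if_neg hi)
  · rw [← Finset.prod_pow]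
    exact prod_eq_one_or_neg_one _ fun i => h2 _ _

/-- The superposition `(|x⟩ + s |y⟩) / √2` of two computational basis states. -/
noncomputable def pairKet {n : ℕ} (x y : Fin n → Fin 2) (s : ℂ) : Ket n :=
  ((1 / Real.sqrt 2 : ℝ) : ℂ) • (Pi.single x 1 + s • Pi.single y 1)

theorem one_div_sqrt_two_mul_self :
    ((1 / Real.sqrt 2 : ℝ) : ℂ) * ((1 / Real.sqrt 2 : ℝ) : ℂ) = 1 / 2 := by
  rw [← Complex.ofReal_mul, div_mul_div_comm, Real.mul_self_sqrt (by positivity)]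
  norm_num

theorem isPureStabilizer_pairKet {n : ℕ} {x y : Fin n → Fin 2} (hxy : x ≠ y) {s : ℂ}
    (hs : s = 1 ∨ s = -1) : IsPureStabilizer (pairKet x y s) := by
  have hc := one_div_sqrt_two_mul_self
  have hs1 : star s = s := by rcases hs with rfl | rfl <;> simp
  have hss : s * s = 1 := by rcases hs with rfl | rfl <;> simp
  have hinner : ∀ (a b : ℂ) (u v : Fin n → Fin 2),
      star (pairKet x y s) ⬝ᵥ
        (((1 / Real.sqrt 2 : ℝ) : ℂ) • (a • Pi.single u 1 + b • Pi.single v 1) : Ket n) =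
      1 / 2 * (a * ((if x = u then 1 else 0) + s * if y = u then 1 else 0) +
        b * ((if x = v then 1 else 0) + s * if y = v then 1 else 0)) := fun a b u v => by
    rw [← hc]
    simp only [pairKet, dotProduct_smul, dotProduct_add, dotProduct_single, Pi.star_apply,
      Pi.smul_apply, Pi.add_apply, star_smul, star_add, Pi.single_apply, smul_eq_mul,
      hs1, Complex.star_def, Complex.conj_ofReal, mul_one, apply_ite (starRingEnd ℂ), map_one,
      map_zero, eq_comm (a := u), eq_comm (a := v)]
    ring
  refine isPureStabilizer_of_forall ?_ fun p => ?_
  · have h := hinner 1 s x y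
    simp only [hxy, hxy.symm, if_true, if_false, mul_zero, mul_one, zero_add, add_zero,
      hss, one_smul] at h
    rw [← pairKet] at h
    rw [h]
    norm_num
  · obtain ⟨f, ph, h1, h2⟩ := exists_pauliString_mulVec_single p
    have hff : ∀ z : Fin n → Fin 2, z + f + f = z := fun z => funext fun i =>
      (by decide : ∀ a b : Fin 2, a + b + b = a) (z i) (f i)
    have hsq : ∀ z, ph z * ph (z + f) = 1 := fun z => by
      have h : pauliString p *ᵥ (pauliString p *ᵥ Pi.single z 1) = Pi.single z 1 := by
        rw [Matrix.mulVec_mulVec, pauliString_mul_self, Matrix.one_mulVec]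
      rw [h1, Matrix.mulVec_smul, h1, hff] at h
      simpa using congrFun h z
    have hP : pauliString p *ᵥ pairKet x y s = ((1 / Real.sqrt 2 : ℝ) : ℂ) •
        (ph x • Pi.single (x + f) 1 + (s * ph y) • Pi.single (y + f) 1) := by
      rw [pairKet, Matrix.mulVec_smul, Matrix.mulVec_add, Matrix.mulVec_smul, h1, h1, smul_smul]
    by_cases hf : f = 0
    · -- A diagonal string multiplies `|x⟩` and `|y⟩` by signs.
      subst hf
      simp only [add_zero] at hP hsq
      have hx := mul_self_eq_one_iff.mp (hsq x)
      have hy := mul_self_eq_one_iff.mp (hsq y)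
      rw [hP, hinner, pairKet]
      rcases hx with hx | hx <;> rcases hy with hy | hy
      · left; left
        simp [hx, hy]
      · right
        simp only [hx, hy, hxy, hxy.symm, if_true, if_false]
        linear_combination (-1 / 2 : ℂ) * hss
      · right
        simp only [hx, hy, hxy, hxy.symm, if_true, if_false]
        linear_combination (1 / 2 : ℂ) * hss
      · left; right
        simp only [hx, hy]
        module
    · have hne : ∀ z : Fin n → Fin 2, z ≠ z + f := fun z h => hf (by simpa using h)
      by_cases hfy : y = x + f
      · -- The string swaps `|x⟩` and `|y⟩`, up to the inverse phases `ph x` and `ph y`.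
        have hfx : x = y + f := by rw [hfy, hff]
        have hxy1 := hsq x
        rw [← hfy] at hxy1
        rw [← hfx, ← hfy] at hP
        rw [hP, hinner, pairKet]
        rcases h2 x with h | h
        · have hyx : ph y = ph x := by linear_combination ph x * hxy1 - ph y * h
          rw [hyx]
          left
          rcases mul_self_eq_one_iff.mp (sq (ph x) ▸ h) with h | h
          · rcases hs with hs | hs
            · left
              rw [h, hs]
              module
            · right
              rw [h, hs]
              module
          · rcases hs with hs | hs
            · right
              rw [h, hs]
              module
            · left
              rw [h, hs]
              module
        · right
          have hyx : ph y = -ph x := by linear_combination -ph x * hxy1 + ph y * h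
          simp only [hyx, hxy, hxy.symm, if_true, if_false]
          ring
      · right
        have hfx : x ≠ y + f := fun h => hfy (by rw [h, hff])
        rw [hP, hinner]
        simp [hne, hfx, hfy]

/-! ### The convex set of stabilizer states and the robustness -/

theorem convex_STAB (n : ℕ) : Convex ℝ (STAB n) := convex_convexHull ℝ _

theorem proj_mem_STAB {n : ℕ} {ψ : Ket n} (h : IsPureStabilizer ψ) : proj ψ ∈ STAB n :=
  subset_convexHull ℝ _ ⟨ψ, h, rfl⟩

/-- A nonnegative combination of points of a nonempty convex set is a multiple of one of its
points; unlike for the center of mass, the total weight may vanish. -/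
theorem exists_mem_sum_smul_eq {E ι : Type*} [AddCommGroup E] [Module ℝ E] {C : Set E}
    (hC : Convex ℝ C) (hne : C.Nonempty) (s : Finset ι) (w : ι → ℝ) (z : ι → E)
    (hw : ∀ i ∈ s, 0 ≤ w i) (hz : ∀ i ∈ s, z i ∈ C) :
    ∃ c ∈ C, ∑ i ∈ s, w i • z i = (∑ i ∈ s, w i) • c := by
  classical
  induction s using Finset.induction_on with
  | empty => exact ⟨hne.some, hne.some_mem, by simp⟩
  | insert i s hi ih =>
    obtain ⟨c, hc, hsum⟩ := ih (fun j hj => hw j (Finset.mem_insert_of_mem hj))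
      fun j hj => hz j (Finset.mem_insert_of_mem hj)
    obtain ⟨d, hd, hadd⟩ := hC.exists_mem_add_smul_eq (hz i (Finset.mem_insert_self i s)) hc
      (hw i (Finset.mem_insert_self i s))
      (Finset.sum_nonneg fun j hj => hw j (Finset.mem_insert_of_mem hj))
    exact ⟨d, hd, by rw [Finset.sum_insert hi, Finset.sum_insert hi, hsum, hadd]⟩

/-- `ρ` is the affine combination with negative weight `-a` of two stabilizer states. -/
def HasStabDecomp {n : ℕ} (ρ : Op n) (a : ℝ) : Prop :=
  0 ≤ a ∧ ∃ σ ∈ STAB n, ∃ τ ∈ STAB n, ρ = (a + 1) • σ - a • τ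

theorem robustness_le {n : ℕ} {ρ : Op n} {a : ℝ} (h : HasStabDecomp ρ a) :
    robustness ρ ≤ 2 * a + 1 := by
  refine csInf_le ⟨0, ?_⟩ ⟨a, h.1, rfl, h.2⟩
  rintro r ⟨b, hb, rfl, -⟩
  linarith

/-- The existence of a decomposition is needed: the infimum of the empty set is `0`. -/
theorem le_robustness {n : ℕ} {ρ : Op n} {c : ℝ} (hne : ∃ a, HasStabDecomp ρ a)
    (h : ∀ a, HasStabDecomp ρ a → c ≤ 2 * a + 1) : c ≤ robustness ρ := by
  obtain ⟨a, ha⟩ := hne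
  refine le_csInf ⟨_, a, ha.1, rfl, ha.2⟩ ?_
  rintro r ⟨b, hb, rfl, hb2⟩
  exact h b ⟨hb, hb2⟩

theorem robustness_nonneg {n : ℕ} (ρ : Op n) : 0 ≤ robustness ρ := by
  refine Real.sInf_nonneg ?_
  rintro r ⟨b, hb, rfl, -⟩
  linarith

theorem pauliNorm_add_le {n : ℕ} (ρ σ : Op n) : pauliNorm (ρ + σ) ≤ pauliNorm ρ + pauliNorm σ := by
  rw [pauliNorm, pauliNorm, pauliNorm, ← mul_add, ← Finset.sum_add_distrib]
  gcongr with p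
  rw [mul_add, Matrix.trace_add]
  exact norm_add_le _ _

theorem pauliNorm_smul {n : ℕ} (c : ℝ) (ρ : Op n) : pauliNorm (c • ρ) = |c| * pauliNorm ρ := by
  simp only [pauliNorm, Matrix.mul_smul, Matrix.trace_smul, norm_smul, ← Finset.mul_sum,
    Real.norm_eq_abs]
  ring

theorem pauliNorm_le_one_of_mem_STAB {n : ℕ} {ρ : Op n} (h : ρ ∈ STAB n) : pauliNorm ρ ≤ 1 := by
  refine convexHull_min (t := {ρ : Op n | pauliNorm ρ ≤ 1}) ?_ ?_ h
  · rintro _ ⟨ψ, hψ, rfl⟩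
    exact (pauliNorm_proj hψ).le
  · intro σ hσ τ hτ a b ha hb hab
    calc pauliNorm (a • σ + b • τ) ≤ |a| * pauliNorm σ + |b| * pauliNorm τ := by
          rw [← pauliNorm_smul, ← pauliNorm_smul]
          exact pauliNorm_add_le _ _
      _ ≤ a * 1 + b * 1 := by
          rw [abs_of_nonneg ha, abs_of_nonneg hb]
          gcongr
          exacts [hσ, hτ]
      _ = 1 := by linarith

/-- The Pauli norm is a seminorm that is at most `1` on stabilizer states, so it bounds the
robustness from below. -/
theorem pauliNorm_le_robustness {n : ℕ} {ρ : Op n} (hne : ∃ a, HasStabDecomp ρ a) :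
    pauliNorm ρ ≤ robustness ρ := by
  refine le_robustness hne ?_
  rintro a ⟨ha, σ, hσ, τ, hτ, rfl⟩
  calc pauliNorm ((a + 1) • σ - a • τ) ≤ |a + 1| * pauliNorm σ + |-a| * pauliNorm τ := by
        rw [← pauliNorm_smul, ← pauliNorm_smul, neg_smul, sub_eq_add_neg]
        exact pauliNorm_add_le _ _
    _ ≤ (a + 1) * 1 + a * 1 := by
        rw [abs_neg, abs_of_nonneg ha, abs_of_nonneg (by linarith : 0 ≤ a + 1)]
        gcongr
        exacts [pauliNorm_le_one_of_mem_STAB hσ, pauliNorm_le_one_of_mem_STAB hτ]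
    _ = 2 * a + 1 := by ring

/-! ### Depolarizing noise as a mixture of Pauli conjugations -/

theorem isPureStabilizer_pauliString_mulVec {n : ℕ} {ψ : Ket n} (h : IsPureStabilizer ψ)
    (p : Fin n → Fin 4) : IsPureStabilizer (pauliString p *ᵥ ψ) := by
  have hinj : ∀ φ χ : Ket n, pauliString p *ᵥ φ = pauliString p *ᵥ χ ↔ φ = χ := fun φ χ =>
    ⟨fun h => by
      simpa [Matrix.mulVec_mulVec, pauliString_mul_self] using
        congrArg (fun v => pauliString p *ᵥ v) h, fun h => h ▸ rfl⟩
  refine ⟨?_, ?_⟩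
  · rw [Matrix.star_mulVec, pauliString_conjTranspose, Matrix.dotProduct_mulVec,
      Matrix.vecMul_vecMul, pauliString_mul_self, Matrix.vecMul_one]
    exact h.1
  · rw [← h.2]
    congr 1
    ext q
    simp only [Set.mem_ofPred_eq, Matrix.mulVec_mulVec]
    rcases pauliString_mul_comm_or q p with hc | hc
    · rw [hc, ← Matrix.mulVec_mulVec, ← Matrix.mulVec_neg, hinj, hinj]
    · rw [hc, Matrix.neg_mulVec, ← Matrix.mulVec_mulVec, neg_inj, neg_eq_iff_eq_neg,
        ← Matrix.mulVec_neg, hinj, hinj, or_comm]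

theorem pauliString_conj_mem_STAB {n : ℕ} {ρ : Op n} (h : ρ ∈ STAB n) (p : Fin n → Fin 4) :
    pauliString p * ρ * pauliString p ∈ STAB n := by
  refine convexHull_min (t := {ρ : Op n | pauliString p * ρ * pauliString p ∈ STAB n}) ?_ ?_ h
  · rintro _ ⟨ψ, hψ, rfl⟩
    have h2 : pauliString p * proj ψ * pauliString p = proj (pauliString p *ᵥ ψ) := by
      rw [proj, proj, Matrix.mul_vecMulVec, Matrix.vecMulVec_mul, Matrix.star_mulVec,
        pauliString_conjTranspose]
    rw [Set.mem_ofPred_eq, h2]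
    exact proj_mem_STAB (isPureStabilizer_pauliString_mulVec hψ p)
  · intro σ hσ τ hτ a b ha hb hab
    rw [Set.mem_ofPred_eq, Matrix.mul_add, Matrix.add_mul, Matrix.mul_smul, Matrix.mul_smul,
      Matrix.smul_mul, Matrix.smul_mul]
    exact convex_STAB n hσ hτ ha hb hab

/-- The probabilities of the single-qubit Pauli errors of the depolarizing channel. -/
noncomputable def errorProb (l : ℝ) (a : Fin 4) : ℝ := if a = 0 then 1 - 3 * l / 4 else l / 4

theorem errorProb_nonneg {l : ℝ} (h0 : 0 ≤ l) (h1 : l ≤ 1) (a : Fin 4) : 0 ≤ errorProb l a := by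
  unfold errorProb
  split_ifs <;> linarith

theorem sum_prod_errorProb (n : ℕ) (l : ℝ) : ∑ p : Fin n → Fin 4, ∏ i, errorProb l (p i) = 1 := by
  rw [sum_prod_pi fun _ => errorProb l]
  refine Finset.prod_eq_one fun i _ => ?_
  simp [Fin.sum_univ_four, errorProb]
  ring

theorem prod_errorProb_zero (n : ℕ) (l : ℝ) :
    ∏ i, errorProb l ((0 : Fin n → Fin 4) i) = (1 - 3 * l / 4) ^ n := by
  simp [errorProb]

theorem depol_single_apply (l : ℝ) (a b c d : Fin 2) :
    depol l (Matrix.single a b 1) c d =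
      (if a = c ∧ b = d then ((1 - l : ℝ) : ℂ) else 0) +
        if a = b ∧ c = d then ((l / 2 : ℝ) : ℂ) else 0 := by
  fin_cases a <;> fin_cases b <;> fin_cases c <;> fin_cases d <;>
    simp [depol, Matrix.trace] <;> ring

theorem depol_single_eq_sum (l : ℝ) (u v x y : Fin 2) :
    depol l (Matrix.single u v 1) x y =
      ∑ a, (errorProb l a : ℂ) * (pauli1 a x u * pauli1 a v y) := by
  rw [depol_single_apply]
  fin_cases u <;> fin_cases v <;> fin_cases x <;> fin_cases y <;>
    simp [Fin.sum_univ_four, pauli1, errorProb] <;> ring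

theorem noise_apply {n : ℕ} (l : ℝ) (ρ : Op n) (x y : Fin n → Fin 2) :
    noise n l ρ x y = ∑ u, ∑ v,
      (∏ i, depol l (Matrix.single (u i) (v i) 1) (x i) (y i)) * ρ u v := rfl

theorem noise_eq_sum {n : ℕ} (l : ℝ) (ρ : Op n) :
    noise n l ρ = ∑ p : Fin n → Fin 4,
      (∏ i, errorProb l (p i)) • (pauliString p * ρ * pauliString p) := by
  ext x y
  have h : ∀ u v : Fin n → Fin 2, ∏ i, depol l (Matrix.single (u i) (v i) 1) (x i) (y i) =
      ∑ p : Fin n → Fin 4, ((∏ i, errorProb l (p i) : ℝ) : ℂ) *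
        (pauliString p x u * pauliString p v y) := fun u v => by
    simp only [depol_single_eq_sum, pauliString_apply, Complex.ofReal_prod,
      ← Finset.prod_mul_distrib]
    rw [sum_prod_pi fun i a => (errorProb l a : ℂ) * (pauli1 a (x i) (u i) * pauli1 a (v i) (y i))]
  simp only [noise_apply, h, Matrix.sum_apply, Matrix.smul_apply, Matrix.mul_apply, Finset.sum_mul,
    Complex.real_smul, Finset.mul_sum]
  rw [Finset.sum_comm]
  simp_rw [Finset.sum_comm (t := (Finset.univ : Finset (Fin n → Fin 4)))]
  refine Finset.sum_congr rfl fun p _ => Finset.sum_congr rfl fun v _ =>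
    Finset.sum_congr rfl fun u _ => ?_
  ring

theorem noise_add {n : ℕ} (l : ℝ) (ρ σ : Op n) :
    noise n l (ρ + σ) = noise n l ρ + noise n l σ := by
  simp only [noise_eq_sum, Matrix.mul_add, Matrix.add_mul, smul_add, Finset.sum_add_distrib]

theorem noise_zero {n : ℕ} (ρ : Op n) : noise n 0 ρ = ρ := by
  rw [noise_eq_sum, Finset.sum_eq_single 0]
  · rw [prod_errorProb_zero, pauliString_zero]
    simp
  · intro p _ hp
    obtain ⟨i, hi⟩ := Function.ne_iff.mp hp
    rw [Finset.prod_eq_zero (Finset.mem_univ i), zero_smul]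
    rw [errorProb, if_neg (show ¬p i = 0 from hi), zero_div]
  · simp

/-- With probability `(1 - 3 l / 4) ^ n` no error occurs; the remaining part of the noise maps
stabilizer states to multiples of stabilizer states. -/
theorem exists_noise_eq_add {n : ℕ} {l : ℝ} (h0 : 0 ≤ l) (h1 : l ≤ 1) :
    ∃ M : Op n →ₗ[ℝ] Op n, (∀ ρ, noise n l ρ = (1 - 3 * l / 4) ^ n • ρ + M ρ) ∧
      ∀ σ ∈ STAB n, ∃ τ ∈ STAB n, M σ = (1 - (1 - 3 * l / 4) ^ n) • τ := by
  classical
  refine ⟨∑ p ∈ Finset.univ.erase (0 : Fin n → Fin 4), (∏ i, errorProb l (p i)) •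
    (LinearMap.mulRight ℝ (pauliString p) ∘ₗ LinearMap.mulLeft ℝ (pauliString p)),
    fun ρ => ?_, fun σ hσ => ?_⟩
  · rw [noise_eq_sum, ← Finset.add_sum_erase _ _ (Finset.mem_univ 0), prod_errorProb_zero]
    rw [pauliString_zero, one_mul, mul_one]
    simp
  · obtain ⟨τ, hτ, h⟩ := exists_mem_sum_smul_eq (convex_STAB n) ⟨σ, hσ⟩
      (Finset.univ.erase (0 : Fin n → Fin 4)) (fun p => ∏ i, errorProb l (p i))
      (fun p => pauliString p * σ * pauliString p)
      (fun p _ => Finset.prod_nonneg fun i _ => errorProb_nonneg h0 h1 _)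
      fun p _ => pauliString_conj_mem_STAB hσ p
    refine ⟨τ, hτ, ?_⟩
    rw [← prod_errorProb_zero, ← sum_prod_errorProb n l,
      ← Finset.add_sum_erase _ _ (Finset.mem_univ (0 : Fin n → Fin 4)), add_sub_cancel_left, ← h]
    simp

theorem noise_mem_STAB {n : ℕ} {l : ℝ} (h0 : 0 ≤ l) (h1 : l ≤ 1) {σ : Op n} (hσ : σ ∈ STAB n) :
    noise n l σ ∈ STAB n := by
  rw [noise_eq_sum]
  exact (convex_STAB n).sum_mem
    (fun p _ => Finset.prod_nonneg fun i _ => errorProb_nonneg h0 h1 _)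
    (sum_prod_errorProb n l) fun p _ => pauliString_conj_mem_STAB hσ p

/-- Noise lowers the robustness slowly: a decomposition of the noisy state, with the Pauli errors
subtracted by means of a decomposition of `ρ`, gives back one of `ρ`. -/
theorem mul_robustness_le_robustness_noise {n : ℕ} {l : ℝ} (h0 : 0 ≤ l) (h1 : l ≤ 1) {ρ : Op n}
    (hρ : ∃ a, HasStabDecomp ρ a) (hne : ∃ a, HasStabDecomp (noise n l ρ) a) :
    (2 * (1 - 3 * l / 4) ^ n - 1) * robustness ρ ≤ robustness (noise n l ρ) := by
  obtain ⟨M, hM, hMS⟩ := exists_noise_eq_add (n := n) h0 h1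
  have hq : 0 < (1 - 3 * l / 4) ^ n := pow_pos (by linarith) n
  have hq1 : (1 - 3 * l / 4) ^ n ≤ 1 := pow_le_one₀ (by linarith) (by linarith)
  generalize (1 - 3 * l / 4) ^ n = q at hM hMS hq hq1 ⊢
  have key : ∀ a, HasStabDecomp (noise n l ρ) a → ∀ b, HasStabDecomp ρ b →
      q * robustness ρ ≤ (2 * a + 1) + (1 - q) * (2 * b + 1) := by
    rintro a ⟨ha, σ, hσ, τ, hτ, h⟩ b ⟨hb, σ', hσ', τ', hτ', h'⟩
    obtain ⟨σ₁, hσ₁, hMσ⟩ := hMS σ' hσ'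
    obtain ⟨τ₁, hτ₁, hMτ⟩ := hMS τ' hτ'
    obtain ⟨σ₂, hσ₂, e1⟩ := (convex_STAB n).exists_mem_add_smul_eq hσ hτ₁
      (by linarith : 0 ≤ a + 1) (mul_nonneg (sub_nonneg.mpr hq1) hb)
    obtain ⟨τ₂, hτ₂, e2⟩ := (convex_STAB n).exists_mem_add_smul_eq hτ hσ₁
      ha (mul_nonneg (sub_nonneg.mpr hq1) (by linarith : 0 ≤ b + 1))
    have hMρ : M ρ = ((1 - q) * (b + 1)) • σ₁ - ((1 - q) * b) • τ₁ := by
      conv_lhs => rw [h']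
      rw [map_sub, map_smul, map_smul, hMσ, hMτ]
      module
    have hqρ : q • ρ = (a + 1 + (1 - q) * b) • σ₂ - (a + (1 - q) * (b + 1)) • τ₂ := by
      have := hM ρ
      rw [h] at this
      rw [e1, e2, eq_sub_of_add_eq this.symm, hMρ]
      module
    have hdec : HasStabDecomp ρ ((a + (1 - q) * (b + 1)) / q) := by
      refine ⟨div_nonneg (add_nonneg ha (mul_nonneg (sub_nonneg.mpr hq1) (by linarith))) hq.le,
        σ₂, hσ₂, τ₂, hτ₂, ?_⟩
      rw [← inv_smul_smul₀ hq.ne' ρ, hqρ, smul_sub, smul_smul, smul_smul]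
      congr 2
      · field_simp
        ring
      · field_simp
    calc q * robustness ρ ≤ q * (2 * ((a + (1 - q) * (b + 1)) / q) + 1) := by
          gcongr
          exact robustness_le hdec
      _ = (2 * a + 1) + (1 - q) * (2 * b + 1) := by
          field_simp
          ring
  have h2 : ∀ b, HasStabDecomp ρ b →
      q * robustness ρ - (1 - q) * (2 * b + 1) ≤ robustness (noise n l ρ) := fun b hb =>
    le_robustness hne fun a ha => by linarith [key a ha b hb]
  -- Only a positive weight `1 - q` allows passing to the infimum over `b`.
  rcases hq1.eq_or_lt with rfl | hq1
  · obtain ⟨b, hb⟩ := hρ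
    linarith [h2 b hb]
  · have h3 : (q * robustness ρ - robustness (noise n l ρ)) / (1 - q) ≤ robustness ρ :=
      le_robustness hρ fun b hb => by
        rw [div_le_iff₀ (by linarith)]
        linarith [h2 b hb]
    rw [div_le_iff₀ (by linarith)] at h3
    linarith

/-! ### Real symmetric matrices as differences of stabilizer states -/

theorem proj_pairKet_sub {n : ℕ} (x y : Fin n → Fin 2) :
    proj (pairKet x y 1) - proj (pairKet x y (-1)) = Matrix.single x y 1 + Matrix.single y x 1 := by
  have hc := one_div_sqrt_two_mul_self
  have hstar : ∀ x v : Fin n → Fin 2, (starRingEnd ℂ) ((Pi.single x 1 : Ket n) v) =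
      (Pi.single x 1 : Ket n) v := fun x v => by
    rw [Pi.single_apply]
    split_ifs <;> simp
  ext u v
  simp only [proj, pairKet, Matrix.sub_apply, Matrix.add_apply, Matrix.vecMulVec_apply,
    Pi.star_apply, Pi.smul_apply, Pi.add_apply, smul_eq_mul, star_mul', star_add, Complex.star_def,
    Complex.conj_ofReal, hstar, map_one, map_neg, Matrix.single_eq_single_vecMulVec_single]
  linear_combination
    (2 * ((Pi.single x 1 : Ket n) u * (Pi.single y 1 : Ket n) v) +
      2 * ((Pi.single y 1 : Ket n) u * (Pi.single x 1 : Ket n) v)) * hc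

/-- A real symmetric matrix with zero diagonal is a multiple of a difference of stabilizer states:
each `|x⟩⟨y| + |y⟩⟨x|` is the difference of the projectors onto `(|x⟩ ± |y⟩) / √2`. -/
theorem exists_eq_smul_sub_of_isSymm {n : ℕ}
    {h : Matrix (Fin n → Fin 2) (Fin n → Fin 2) ℝ} (hsymm : h.IsSymm) (hdiag : ∀ x, h x x = 0) :
    ∃ σ ∈ STAB n, ∃ τ ∈ STAB n,
      h.map Complex.ofReal = (1 / 2 * ∑ x, ∑ y, |h x y|) • (σ - τ) := by
  have hne : (STAB n).Nonempty := ⟨_, proj_mem_STAB (isPureStabilizer_plusKet n)⟩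
  have hxy : ∀ z : (Fin n → Fin 2) × (Fin n → Fin 2), ∃ σ ∈ STAB n, ∃ τ ∈ STAB n,
      h z.1 z.2 • (Matrix.single z.1 z.2 (1 : ℂ) + Matrix.single z.2 z.1 1) =
        |h z.1 z.2| • (σ - τ) := by
    rintro ⟨x, y⟩
    by_cases hxy : x = y
    · obtain ⟨σ, hσ⟩ := hne
      exact ⟨σ, hσ, σ, hσ, by simp [hxy, hdiag]⟩
    · have hp := proj_mem_STAB (isPureStabilizer_pairKet hxy (Or.inl rfl))
      have hm := proj_mem_STAB (isPureStabilizer_pairKet hxy (Or.inr rfl))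
      rcases le_total 0 (h x y) with h0 | h0
      · exact ⟨_, hp, _, hm, by rw [proj_pairKet_sub, abs_of_nonneg h0]⟩
      · refine ⟨_, hm, _, hp, ?_⟩
        rw [← neg_sub (proj _), proj_pairKet_sub, abs_of_nonpos h0, smul_neg, neg_smul, neg_neg]
  choose σ hσ τ hτ hxy using hxy
  obtain ⟨s, hs, es⟩ := exists_mem_sum_smul_eq (convex_STAB n) hne Finset.univ
    (fun z => |h z.1 z.2|) σ (fun _ _ => abs_nonneg _) fun z _ => hσ z
  obtain ⟨t, ht, et⟩ := exists_mem_sum_smul_eq (convex_STAB n) hne Finset.univ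
    (fun z => |h z.1 z.2|) τ (fun _ _ => abs_nonneg _) fun z _ => hτ z
  refine ⟨s, hs, t, ht, ?_⟩
  have hsum : ∑ z : (Fin n → Fin 2) × (Fin n → Fin 2),
      h z.1 z.2 • (Matrix.single z.1 z.2 (1 : ℂ) + Matrix.single z.2 z.1 1) =
      (2 : ℝ) • h.map Complex.ofReal := by
    have h1 : ∑ x, ∑ y, h x y • Matrix.single x y (1 : ℂ) = h.map Complex.ofReal := by
      conv_rhs => rw [Matrix.matrix_eq_sum_single (h.map Complex.ofReal)]
      simp [Matrix.smul_single]
    have h2 : ∑ x, ∑ y, h x y • Matrix.single y x (1 : ℂ) = h.map Complex.ofReal := by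
      rw [← h1, Finset.sum_comm]
      refine Finset.sum_congr rfl fun x _ => Finset.sum_congr rfl fun y _ => ?_
      rw [hsymm.apply]
    rw [Fintype.sum_prod_type]
    simp only [smul_add, Finset.sum_add_distrib, h1, h2]
    rw [two_smul]
  simp only [hxy, smul_sub, Finset.sum_sub_distrib, es, et] at hsum
  rw [← smul_sub, Fintype.sum_prod_type] at hsum
  rw [mul_smul, hsum, smul_smul]
  norm_num

/-! ### The upper bound on the robustness -/

/-- The diagonal entries of the multi-controlled-`Z` gate: the sign `-1` for the all-ones string only. -/
def czSign {n : ℕ} (x : Fin n → Fin 2) : ℝ := 1 - 2 * if x = 1 then 1 else 0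

theorem plusKet_mul_star {n : ℕ} (x y : Fin n → Fin 2) :
    plusKet n x * star (plusKet n y) = ((1 / 2 ^ n : ℝ) : ℂ) := by
  rw [plusKet, plusKet, Complex.star_def, Complex.conj_ofReal, ← Complex.ofReal_mul,
    div_mul_div_comm, Real.mul_self_sqrt (by positivity), one_mul]

theorem czState_apply {n : ℕ} (x y : Fin n → Fin 2) :
    czState n x y = ((1 / 2 ^ n * (czSign x * czSign y) : ℝ) : ℂ) := by
  have h : ∀ x : Fin n → Fin 2, (multiCZ n *ᵥ plusKet n) x = (czSign x : ℂ) * plusKet n x :=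
    fun x => by
      rw [multiCZ, Matrix.mulVec_diagonal, czSign]
      by_cases hx : x = 1
      · norm_num [hx]
      · have hx2 : ¬∀ i, x i = 1 := fun h => hx (funext h)
        simp [hx, hx2]
  rw [czState, proj, Matrix.vecMulVec_apply, Pi.star_apply, h, h, star_mul', mul_mul_mul_comm,
    plusKet_mul_star, Complex.star_def, Complex.conj_ofReal]
  push_cast
  ring

/-- The difference of the density operators of `C^{n-1}Z |+ⁿ⟩` and `|+ⁿ⟩`. -/
noncomputable def czDiff (n : ℕ) : Matrix (Fin n → Fin 2) (Fin n → Fin 2) ℝ :=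
  Matrix.of fun x y => 1 / 2 ^ n * (czSign x * czSign y - 1)

theorem czState_eq_add (n : ℕ) :
    czState n = proj (plusKet n) + (czDiff n).map Complex.ofReal := by
  ext x y
  rw [czState_apply, Matrix.add_apply, proj, Matrix.vecMulVec_apply, Pi.star_apply,
    plusKet_mul_star, Matrix.map_apply, czDiff, Matrix.of_apply, ← Complex.ofReal_add]
  congr 1
  ring

theorem czDiff_self {n : ℕ} (x : Fin n → Fin 2) : czDiff n x x = 0 := by
  simp only [czDiff, Matrix.of_apply, czSign]
  split_ifs <;> norm_num

theorem abs_czDiff_le {n : ℕ} (x y : Fin n → Fin 2) :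
    |czDiff n x y| ≤ 2 / 2 ^ n * ((if x = 1 then 1 else 0) + if y = 1 then 1 else 0) := by
  have hN : (0 : ℝ) < 2 ^ n := by positivity
  simp only [czDiff, Matrix.of_apply, czSign]
  split_ifs <;> simp [abs_of_pos hN] <;> norm_num <;> field_simp <;> norm_num

/-- The matrix element `⟨c| E(|a⟩⟨b|) |d⟩` of the depolarizing channel `E`. -/
noncomputable def depolEntry (l : ℝ) (a b c d : Fin 2) : ℝ :=
  (if a = c ∧ b = d then 1 - l else 0) + if a = b ∧ c = d then l / 2 else 0

theorem depol_single_eq_depolEntry (l : ℝ) (a b c d : Fin 2) :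
    depol l (Matrix.single a b 1) c d = (depolEntry l a b c d : ℂ) := by
  rw [depol_single_apply, depolEntry]
  split_ifs <;> simp

/-- The action of the noise on real matrices, by the same kernel as `noise`. -/
noncomputable def noiseReal (n : ℕ) (l : ℝ) (h : Matrix (Fin n → Fin 2) (Fin n → Fin 2) ℝ) :
    Matrix (Fin n → Fin 2) (Fin n → Fin 2) ℝ :=
  Matrix.of fun x y => ∑ u, ∑ v, (∏ i, depolEntry l (u i) (v i) (x i) (y i)) * h u v

theorem noise_map_ofReal {n : ℕ} (l : ℝ) (h : Matrix (Fin n → Fin 2) (Fin n → Fin 2) ℝ) :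
    noise n l (h.map Complex.ofReal) = (noiseReal n l h).map Complex.ofReal := by
  ext x y
  simp [noise_apply, noiseReal, depol_single_eq_depolEntry]

theorem noiseReal_isSymm {n : ℕ} (l : ℝ) {h : Matrix (Fin n → Fin 2) (Fin n → Fin 2) ℝ}
    (hsymm : h.IsSymm) : (noiseReal n l h).IsSymm := by
  ext x y
  simp only [noiseReal, Matrix.transpose_apply, Matrix.of_apply]
  rw [Finset.sum_comm]
  refine Finset.sum_congr rfl fun u _ => Finset.sum_congr rfl fun v _ => ?_
  rw [hsymm.apply]
  congr 1
  refine Finset.prod_congr rfl fun i _ => ?_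
  simp only [depolEntry, and_comm, eq_comm]

theorem noiseReal_self {n : ℕ} (l : ℝ) {h : Matrix (Fin n → Fin 2) (Fin n → Fin 2) ℝ}
    (hdiag : ∀ x, h x x = 0) (x : Fin n → Fin 2) : noiseReal n l h x x = 0 := by
  refine Finset.sum_eq_zero fun u _ => Finset.sum_eq_zero fun v _ => ?_
  by_cases huv : u = v
  · rw [huv, hdiag, mul_zero]
  · obtain ⟨i, hi⟩ := Function.ne_iff.mp huv
    rw [Finset.prod_eq_zero (Finset.mem_univ i), zero_mul]
    have h1 : ¬(u i = x i ∧ v i = x i) := fun h => hi (h.1.trans h.2.symm)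
    simp [depolEntry, hi, h1]

theorem sum_abs_noiseReal_le {n : ℕ} {l : ℝ} (h0 : 0 ≤ l) (h1 : l ≤ 1)
    (h : Matrix (Fin n → Fin 2) (Fin n → Fin 2) ℝ) :
    ∑ x, ∑ y, |noiseReal n l h x y| ≤
      ∑ u, ∑ v, (∏ i, if u i = v i then 1 else 1 - l) * |h u v| := by
  have hnn : ∀ a b c d, 0 ≤ depolEntry l a b c d := fun a b c d => by
    unfold depolEntry
    split_ifs <;> linarith
  have hsum : ∀ a b, ∑ c, ∑ d, depolEntry l a b c d = if a = b then 1 else 1 - l := fun a b => by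
    fin_cases a <;> fin_cases b <;> simp [depolEntry] <;> ring
  calc ∑ x, ∑ y, |noiseReal n l h x y|
      ≤ ∑ x : Fin n → Fin 2, ∑ y : Fin n → Fin 2, ∑ u, ∑ v,
          (∏ i, depolEntry l (u i) (v i) (x i) (y i)) * |h u v| := by
        gcongr with x _ y _
        refine (Finset.abs_sum_le_sum_abs _ _).trans ?_
        gcongr with u _
        refine (Finset.abs_sum_le_sum_abs _ _).trans ?_
        gcongr with v _
        rw [abs_mul, abs_of_nonneg (Finset.prod_nonneg fun i _ => hnn _ _ _ _)]
    _ = ∑ u, ∑ v, (∑ x : Fin n → Fin 2, ∑ y : Fin n → Fin 2,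
          ∏ i, depolEntry l (u i) (v i) (x i) (y i)) * |h u v| := by
        simp only [Finset.sum_mul]
        exact sum_sum_comm_sum_sum _
    _ = _ := by
        refine Finset.sum_congr rfl fun u _ => Finset.sum_congr rfl fun v _ => ?_
        rw [sum_sum_prod_pi fun i a b => depolEntry l (u i) (v i) a b]
        simp only [hsum]

theorem sum_prod_ite_one {n : ℕ} (l : ℝ) :
    ∑ u : Fin n → Fin 2, ∏ i, (if u i = 1 then 1 else 1 - l) = (2 - l) ^ n := by
  rw [sum_prod_pi fun _ a => if a = 1 then 1 else 1 - l]
  simp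
  ring

/-- The part of the noisy state that is not a stabilizer state has entries of total absolute value
at most `4 (1 - l / 2) ^ n`. -/
theorem sum_abs_noiseReal_czDiff_le {n : ℕ} {l : ℝ} (h0 : 0 ≤ l) (h1 : l ≤ 1) :
    ∑ x, ∑ y, |noiseReal n l (czDiff n) x y| ≤ 4 * (1 - l / 2) ^ n := by
  have hnn : ∀ u v : Fin n → Fin 2, 0 ≤ ∏ i, (if u i = v i then 1 else 1 - l) := fun u v =>
    Finset.prod_nonneg fun i _ => by split_ifs <;> linarith
  have hcol : ∑ v : Fin n → Fin 2, ∏ i, (if (1 : Fin n → Fin 2) i = v i then 1 else 1 - l) =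
      (2 - l) ^ n := by
    rw [← sum_prod_ite_one]
    simp only [Pi.one_apply, eq_comm]
  calc _ ≤ _ := sum_abs_noiseReal_le h0 h1 _
    _ ≤ ∑ u : Fin n → Fin 2, ∑ v : Fin n → Fin 2, (∏ i, if u i = v i then 1 else 1 - l) *
          (2 / 2 ^ n * ((if u = 1 then 1 else 0) + if v = 1 then 1 else 0)) := by
        gcongr with u _ v _
        exact abs_czDiff_le u v
    _ = 2 / 2 ^ n * (2 * (2 - l) ^ n) := by
        simp only [mul_add, Finset.sum_add_distrib, mul_ite, mul_one, mul_zero]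
        rw [Finset.sum_comm]
        simp only [Finset.sum_ite_eq', Finset.mem_univ, if_true, ← Finset.sum_mul, hcol]
        rw [show ∑ u : Fin n → Fin 2, ∏ i, (if u i = (1 : Fin n → Fin 2) i then 1 else 1 - l) =
          (2 - l) ^ n from sum_prod_ite_one l]
        ring
    _ = 4 * (1 - l / 2) ^ n := by
        rw [show 1 - l / 2 = (2 - l) / 2 by ring, div_pow]
        ring

theorem hasStabDecomp_noise_czState {n : ℕ} {l : ℝ} (h0 : 0 ≤ l) (h1 : l ≤ 1) :
    HasStabDecomp (noise n l (czState n)) (2 * (1 - l / 2) ^ n) := by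
  have hsymm : (czDiff n).IsSymm := by
    ext x y
    simp only [czDiff, Matrix.transpose_apply, Matrix.of_apply, mul_comm]
  obtain ⟨σ, hσ, τ, hτ, h⟩ := exists_eq_smul_sub_of_isSymm (noiseReal_isSymm l hsymm)
    (noiseReal_self l czDiff_self)
  have hle := sum_abs_noiseReal_czDiff_le (n := n) h0 h1
  have hnn : 0 ≤ ∑ x, ∑ y, |noiseReal n l (czDiff n) x y| :=
    Finset.sum_nonneg fun x _ => Finset.sum_nonneg fun y _ => abs_nonneg _
  generalize ∑ x, ∑ y, |noiseReal n l (czDiff n) x y| = s at h hle hnn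
  have hplus := noise_mem_STAB h0 h1 (proj_mem_STAB (isPureStabilizer_plusKet n))
  -- The slack in the bound on `s` is absorbed by adding a multiple of `σ` to both terms.
  generalize (1 - l / 2) ^ n = q at hle ⊢
  obtain ⟨σ₁, hσ₁, e1⟩ := (convex_STAB n).exists_mem_add_smul_eq hplus hσ zero_le_one
    (by linarith : 0 ≤ 2 * q)
  obtain ⟨τ₁, hτ₁, e2⟩ := (convex_STAB n).exists_mem_add_smul_eq hτ hσ
    (by linarith : 0 ≤ 1 / 2 * s) (by linarith : 0 ≤ 2 * q - 1 / 2 * s)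
  refine ⟨by linarith, σ₁, hσ₁, τ₁, hτ₁, ?_⟩
  rw [czState_eq_add, noise_add, noise_map_ofReal, h, add_comm (2 * q) 1, e1,
    show 2 * q = 1 / 2 * s + (2 * q - 1 / 2 * s) by ring, e2]
  module

theorem hasStabDecomp_czState (n : ℕ) : ∃ a, HasStabDecomp (czState n) a :=
  ⟨_, by simpa only [noise_zero] using hasStabDecomp_noise_czState (n := n) le_rfl zero_le_one⟩

theorem robustness_noise_czState_le {n : ℕ} {l : ℝ} (h0 : 0 ≤ l) (h1 : l ≤ 1) :
    robustness (noise n l (czState n)) ≤ 1 + 4 * (1 - l / 2) ^ n :=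
  (robustness_le (hasStabDecomp_noise_czState h0 h1)).trans_eq (by ring)

/-! ### The Pauli spectrum of the noisy state -/

/-- The depolarizing noise damps each Pauli coefficient by `1 - l` per non-identity site. -/
theorem trace_pauliString_mul_noise {n : ℕ} (l : ℝ) (p : Fin n → Fin 4) (ρ : Op n) :
    (pauliString p * noise n l ρ).trace =
      ((∏ i, if p i = 0 then 1 else 1 - l : ℝ) : ℂ) * (pauliString p * ρ).trace := by
  have hsite : ∀ (a : Fin 4) (u v : Fin 2),
      ∑ x, ∑ y, pauli1 a x y * depol l (Matrix.single u v 1) y x =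
        ((if a = 0 then 1 else 1 - l : ℝ) : ℂ) * pauli1 a v u := fun a u v => by
    simp only [depol_single_apply]
    fin_cases a <;> fin_cases u <;> fin_cases v <;> simp [pauli1] <;> ring
  have hprod : ∀ u v : Fin n → Fin 2, ∑ x, ∑ y, pauliString p x y *
      ∏ i, depol l (Matrix.single (u i) (v i) 1) (y i) (x i) =
        ((∏ i, if p i = 0 then 1 else 1 - l : ℝ) : ℂ) * pauliString p v u := fun u v => by
    simp only [pauliString_apply, ← Finset.prod_mul_distrib, Complex.ofReal_prod, ← hsite]
    exact sum_sum_prod_pi fun i a b =>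
      pauli1 (p i) a b * depol l (Matrix.single (u i) (v i) 1) b a
  rw [trace_mul_eq_sum, trace_mul_eq_sum]
  calc ∑ x, ∑ y, pauliString p x y * noise n l ρ y x
      = ∑ u, ∑ v, (∑ x, ∑ y, pauliString p x y *
          ∏ i, depol l (Matrix.single (u i) (v i) 1) (y i) (x i)) * ρ u v := by
        simp only [noise_apply, Finset.mul_sum, Finset.sum_mul, mul_assoc]
        exact sum_sum_comm_sum_sum _
    _ = _ := by
        simp only [hprod, Finset.mul_sum, mul_assoc]
        exact Finset.sum_comm

/-- The four terms come from `czSign x * czSign y = (1 - 2 [x = 1]) (1 - 2 [y = 1])`. -/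
theorem two_pow_mul_trace_czState {n : ℕ} (p : Fin n → Fin 4) :
    2 ^ n * (pauliString p * czState n).trace =
      (∏ i, ![2, 2, 0, 0] (p i)) - 2 * (∏ i, ![1, 1, Complex.I, -1] (p i)) -
        2 * (∏ i, ![1, 1, -Complex.I, -1] (p i)) + 4 * ∏ i, ![1, 0, 0, -1] (p i) := by
  have hS : ∀ a : Fin 4, ∑ x, ∑ y, pauli1 a x y = ![2, 2, 0, 0] a := fun a => by
    fin_cases a <;> simp [pauli1] <;> norm_num
  have hR : ∀ a : Fin 4, ∑ y, pauli1 a 1 y = ![1, 1, Complex.I, -1] a := fun a => by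
    fin_cases a <;> simp [pauli1]
  have hC : ∀ a : Fin 4, ∑ x, pauli1 a x 1 = ![1, 1, -Complex.I, -1] a := fun a => by
    fin_cases a <;> simp [pauli1]
  have hD : ∀ a : Fin 4, pauli1 a 1 1 = ![1, 0, 0, -1] a := fun a => by
    fin_cases a <;> simp [pauli1]
  simp only [← hS, ← hR, ← hC, ← hD]
  rw [← sum_sum_prod_pi fun i a b => pauli1 (p i) a b, ← sum_prod_pi fun i b => pauli1 (p i) 1 b,
    ← sum_prod_pi fun i a => pauli1 (p i) a 1, trace_mul_eq_sum]
  have hterm : ∀ x y : Fin n → Fin 2, 2 ^ n * (pauliString p x y * czState n y x) =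
      pauliString p x y - 2 * (if x = 1 then pauliString p x y else 0) -
        2 * (if y = 1 then pauliString p x y else 0) +
        4 * if x = 1 then (if y = 1 then pauliString p x y else 0) else 0 := fun x y => by
    have hN : (2 : ℂ) ^ n ≠ 0 := pow_ne_zero n two_ne_zero
    rw [czState_apply]
    simp only [czSign]
    split_ifs <;> push_cast <;> field_simp <;> ring
  simp only [Finset.mul_sum, hterm]
  simp only [Finset.sum_add_distrib, Finset.sum_sub_distrib, ← Finset.mul_sum]
  have hrow : ∑ x : Fin n → Fin 2, ∑ y, (if x = 1 then pauliString p x y else 0) =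
      ∑ y, pauliString p 1 y := by
    rw [Finset.sum_comm]
    simp
  simp only [hrow, Finset.sum_ite_eq', Finset.mem_univ, if_true]
  have hcorner : ∑ x : Fin n → Fin 2, ∑ y : Fin n → Fin 2,
      (if x = 1 then (if y = 1 then pauliString p x y else 0) else 0) = pauliString p 1 1 := by
    rw [Finset.sum_comm]
    simp
  rw [hcorner]
  rfl

theorem prod_comp_eq_zero {ι κ R : Type*} [Fintype ι] [CommSemiring R] (p : ι → κ) {f : κ → R}
    {i : ι} (h : f (p i) = 0) : ∏ j, f (p j) = 0 :=
  Finset.prod_eq_zero (Finset.mem_univ i) h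

/-- The absolute values of the Pauli coefficients, as a combination of product functions: the
indicators of the strings over `{I, X}` and over `{I, Z}` and of the identity, and the parity of the
number of `Y`s. -/
theorem two_pow_mul_norm_trace_czState {n : ℕ} (hn : 2 ≤ n) (p : Fin n → Fin 4) :
    2 ^ n * ‖(pauliString p * czState n).trace‖ =
      (2 ^ n - 8) * (∏ i, ![1, 1, 0, 0] (p i)) - 4 * (∏ i, ![1, 0, 0, 1] (p i)) +
        8 * (∏ i, ![1, 0, 0, 0] (p i)) + 2 * (1 + ∏ i, ![1, 1, -1, 1] (p i)) := by
  have hN : (4 : ℝ) ≤ 2 ^ n := by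
    calc (4 : ℝ) = 2 ^ 2 := by norm_num
      _ ≤ 2 ^ n := pow_le_pow_right₀ one_le_two hn
  have hnorm : 2 ^ n * ‖(pauliString p * czState n).trace‖ =
      ‖2 ^ n * (pauliString p * czState n).trace‖ := by simp
  rw [hnorm, two_pow_mul_trace_czState]
  by_cases hX : ∀ i, p i = 0 ∨ p i = 1
  · have e1 : ∏ i, (![2, 2, 0, 0] : Fin 4 → ℂ) (p i) = 2 ^ n := by
      rw [Finset.prod_congr rfl (g := fun _ => 2) fun i _ => by rcases hX i with h | h <;> simp [h]]
      simp
    have e2 : ∏ i, (![1, 1, Complex.I, -1] : Fin 4 → ℂ) (p i) = 1 :=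
      Finset.prod_eq_one fun i _ => by rcases hX i with h | h <;> simp [h]
    have e3 : ∏ i, (![1, 1, -Complex.I, -1] : Fin 4 → ℂ) (p i) = 1 :=
      Finset.prod_eq_one fun i _ => by rcases hX i with h | h <;> simp [h]
    have e4 : ∏ i, (![1, 1, 0, 0] : Fin 4 → ℝ) (p i) = 1 :=
      Finset.prod_eq_one fun i _ => by rcases hX i with h | h <;> simp [h]
    have e5 : ∏ i, (![1, 1, -1, 1] : Fin 4 → ℝ) (p i) = 1 :=
      Finset.prod_eq_one fun i _ => by rcases hX i with h | h <;> simp [h]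
    rw [e1, e2, e3, e4, e5]
    by_cases h0 : ∀ i, p i = 0
    · simp only [h0, Matrix.cons_val_zero, Finset.prod_const_one]
      rw [show (2 : ℂ) ^ n - 2 * 1 - 2 * 1 + 4 * 1 = 2 ^ n by ring]
      simp
      ring
    · push Not at h0
      obtain ⟨i, hi⟩ := h0
      have hi1 := (hX i).resolve_left hi
      have e6 : (![1, 0, 0, -1] : Fin 4 → ℂ) (p i) = 0 := by simp [hi1]
      have e7 : (![1, 0, 0, 1] : Fin 4 → ℝ) (p i) = 0 := by simp [hi1]
      have e8 : (![1, 0, 0, 0] : Fin 4 → ℝ) (p i) = 0 := by simp [hi1]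
      rw [prod_comp_eq_zero p e6, prod_comp_eq_zero p e7,
        prod_comp_eq_zero p e8,
        show (2 : ℂ) ^ n - 2 * 1 - 2 * 1 + 4 * 0 = ((2 ^ n - 4 : ℝ) : ℂ) by push_cast; ring,
        Complex.norm_real, Real.norm_eq_abs, abs_of_nonneg (by linarith)]
      ring
  · push Not at hX
    obtain ⟨i, hi0, hi1⟩ := hX
    have e1 : (![2, 2, 0, 0] : Fin 4 → ℂ) (p i) = 0 := by
      generalize p i = a at hi0 hi1
      fin_cases a <;> simp_all
    have e2 : (![1, 1, 0, 0] : Fin 4 → ℝ) (p i) = 0 := by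
      generalize p i = a at hi0 hi1
      fin_cases a <;> simp_all
    have e3 : (![1, 0, 0, 0] : Fin 4 → ℝ) (p i) = 0 := by
      generalize p i = a at hi0 hi1
      fin_cases a <;> simp_all
    rw [prod_comp_eq_zero p e1, prod_comp_eq_zero p e2,
      prod_comp_eq_zero p e3]
    by_cases hZ : ∀ i, p i = 0 ∨ p i = 3
    · have e2 : ∏ i, (![1, 1, Complex.I, -1] : Fin 4 → ℂ) (p i) = ∏ i, ![1, 0, 0, -1] (p i) :=
        Finset.prod_congr rfl fun i _ => by rcases hZ i with h | h <;> simp [h]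
      have e3 : ∏ i, (![1, 1, -Complex.I, -1] : Fin 4 → ℂ) (p i) = ∏ i, ![1, 0, 0, -1] (p i) :=
        Finset.prod_congr rfl fun i _ => by rcases hZ i with h | h <;> simp [h]
      have e4 : ∏ i, (![1, 0, 0, 1] : Fin 4 → ℝ) (p i) = 1 :=
        Finset.prod_eq_one fun i _ => by rcases hZ i with h | h <;> simp [h]
      have e5 : ∏ i, (![1, 1, -1, 1] : Fin 4 → ℝ) (p i) = 1 :=
        Finset.prod_eq_one fun i _ => by rcases hZ i with h | h <;> simp [h]
      rw [e2, e3, e4, e5]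
      ring_nf
      simp
    · push Not at hZ
      obtain ⟨j, hj0, hj3⟩ := hZ
      have e4 : (![1, 0, 0, -1] : Fin 4 → ℂ) (p j) = 0 := by
        generalize p j = a at hj0 hj3
        fin_cases a <;> simp_all
      have e5 : (![1, 0, 0, 1] : Fin 4 → ℝ) (p j) = 0 := by
        generalize p j = a at hj0 hj3
        fin_cases a <;> simp_all
      rw [prod_comp_eq_zero p e4, prod_comp_eq_zero p e5]
      -- The products `r` and `c` of the row and column sums are inverse, and `r ^ 2` is the parity.
      have hrc : (∏ i, (![1, 1, Complex.I, -1] : Fin 4 → ℂ) (p i)) *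
          ∏ i, (![1, 1, -Complex.I, -1] : Fin 4 → ℂ) (p i) = 1 := by
        rw [← Finset.prod_mul_distrib]
        refine Finset.prod_eq_one fun i _ => ?_
        generalize p i = a
        fin_cases a <;> simp
      have hrr : (∏ i, (![1, 1, Complex.I, -1] : Fin 4 → ℂ) (p i)) *
          ∏ i, (![1, 1, Complex.I, -1] : Fin 4 → ℂ) (p i) =
            ((∏ i, (![1, 1, -1, 1] : Fin 4 → ℝ) (p i) : ℝ) : ℂ) := by
        rw [← Finset.prod_mul_distrib, Complex.ofReal_prod]
        refine Finset.prod_congr rfl fun i _ => ?_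
        generalize p i = a
        fin_cases a <;> simp
      have hη : ∏ i, (![1, 1, -1, 1] : Fin 4 → ℝ) (p i) = 1 ∨
          ∏ i, (![1, 1, -1, 1] : Fin 4 → ℝ) (p i) = -1 := by
        refine Finset.prod_induction _ (fun z : ℝ => z = 1 ∨ z = -1) ?_ (Or.inl rfl) fun i _ => ?_
        · rintro a b (rfl | rfl) (rfl | rfl) <;> simp
        · generalize p i = a
          fin_cases a <;> simp
      generalize ∏ i, (![1, 1, Complex.I, -1] : Fin 4 → ℂ) (p i) = r at hrc hrr ⊢
      generalize ∏ i, (![1, 1, -Complex.I, -1] : Fin 4 → ℂ) (p i) = c at hrc ⊢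
      generalize ∏ i, (![1, 1, -1, 1] : Fin 4 → ℝ) (p i) = η at hrr hη ⊢
      rcases hη with rfl | rfl
      · have hcr : c = r := by
          push_cast at hrr
          linear_combination r * hrc - c * hrr
        have hr : ‖r‖ = 1 := by
          have := congrArg norm hrr
          rw [norm_mul] at this
          simp only [Complex.ofReal_one, norm_one] at this
          rcases mul_self_eq_one_iff.mp this with h | h
          · exact h
          · linarith [norm_nonneg r]
        rw [hcr, show (0 : ℂ) - 2 * r - 2 * r + 4 * 0 = -4 * r by ring, norm_mul, hr]
        norm_num
      · have hcr : c = -r := by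
          push_cast at hrr
          linear_combination -r * hrc + c * hrr
        rw [hcr]
        ring_nf
        simp

theorem sum_prod_mul_prod {n : ℕ} (f g : Fin 4 → ℝ) :
    ∑ p : Fin n → Fin 4, (∏ i, f (p i)) * ∏ i, g (p i) = (∑ a, f a * g a) ^ n := by
  simp only [← Finset.prod_mul_distrib]
  rw [sum_prod_pi fun _ a => f a * g a]
  simp

theorem pauliNorm_noise_czState {n : ℕ} (hn : 2 ≤ n) {l : ℝ} (h1 : l ≤ 1) :
    pauliNorm (noise n l (czState n)) =
      2 * (1 - 3 * l / 4) ^ n + (1 - l / 2) ^ n + 8 / 4 ^ n - 10 * (1 / 2 - l / 4) ^ n := by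
  have hN : (0 : ℝ) < 2 ^ n := by positivity
  have hterm : ∀ p : Fin n → Fin 4, 2 ^ n * ‖(pauliString p * noise n l (czState n)).trace‖ =
      (2 ^ n - 8) * ((∏ i, if p i = 0 then 1 else 1 - l) * (∏ i, ![1, 1, 0, 0] (p i))) -
        4 * ((∏ i, if p i = 0 then 1 else 1 - l) * (∏ i, ![1, 0, 0, 1] (p i))) +
        8 * ((∏ i, if p i = 0 then 1 else 1 - l) * (∏ i, ![1, 0, 0, 0] (p i))) +
        2 * ((∏ i, if p i = 0 then 1 else 1 - l) * (∏ i, ![1, 1, 1, 1] (p i))) +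
        2 * ((∏ i, if p i = 0 then 1 else 1 - l) * ∏ i, ![1, 1, -1, 1] (p i)) := fun p => by
    have hone : ∏ i, (![1, 1, 1, 1] : Fin 4 → ℝ) (p i) = 1 := Finset.prod_eq_one fun i _ => by
      generalize p i = a
      fin_cases a <;> simp
    have hnn : 0 ≤ ∏ i, (if p i = 0 then 1 else 1 - l) :=
      Finset.prod_nonneg fun i _ => by split_ifs <;> linarith
    rw [trace_pauliString_mul_noise, norm_mul, Complex.norm_real, Real.norm_eq_abs,
      abs_of_nonneg hnn, mul_left_comm, two_pow_mul_norm_trace_czState hn, hone]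
    ring
  have hsum : 2 ^ n * ∑ p, ‖(pauliString p * noise n l (czState n)).trace‖ =
      (2 ^ n - 10) * (2 - l) ^ n + 8 + 2 * (4 - 3 * l) ^ n := by
    simp only [Finset.mul_sum, hterm]
    simp only [Finset.sum_add_distrib, Finset.sum_sub_distrib, ← Finset.mul_sum]
    have hs := sum_prod_mul_prod (n := n) fun a : Fin 4 => if a = 0 then 1 else 1 - l
    simp only [hs, Fin.sum_univ_four]
    simp
    rw [show 1 + (1 - l) = 2 - l by ring, show 2 - l + (1 - l) + (1 - l) = 4 - 3 * l by ring]
    ring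
  have e1 : (2 - l) ^ n = 2 ^ n * (1 - l / 2) ^ n := by
    rw [← mul_pow]
    ring_nf
  have e2 : (4 - 3 * l) ^ n = 2 ^ n * (2 ^ n * (1 - 3 * l / 4) ^ n) := by
    rw [← mul_pow, ← mul_pow]
    ring_nf
  have e3 : (1 / 2 - l / 4) ^ n = (1 - l / 2) ^ n / 2 ^ n := by
    rw [← div_pow]
    ring_nf
  have e4 : (4 : ℝ) ^ n = 2 ^ n * 2 ^ n := by
    rw [← mul_pow]
    norm_num
  rw [pauliNorm, eq_div_of_mul_eq hN.ne' ((mul_comm _ _).trans hsum), e1, e2, e3, e4]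
  field_simp
  ring

/-! ### Asymptotics of the threshold -/

theorem threshold_nonneg {n : ℕ} (ε : ℝ) (ρ : Op n) : 0 ≤ threshold ε ρ :=
  Real.sInf_nonneg fun _ hl => hl.1.1

/-- At noise rate `c / n` the upper bound `1 + 4 (1 - l / 2) ^ n` is at most `1 + 4 e ^ (-c / 2)`;
`c` is chosen such that this is at most `1 + ε`. -/
theorem exists_forall_robustness_le {ε : ℝ} (hε : 0 < ε) :
    ∃ c : ℝ, 0 ≤ c ∧ ∀ n : ℕ, 1 ≤ n → c ≤ n →
      robustness (noise n (c / n) (czState n)) ≤ 1 + ε := by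
  refine ⟨max 0 (2 * Real.log (4 / ε)), le_max_left _ _, fun n hn hc => ?_⟩
  have hlog : 2 * Real.log (4 / ε) ≤ max 0 (2 * Real.log (4 / ε)) := le_max_right _ _
  have hc0 : 0 ≤ max 0 (2 * Real.log (4 / ε)) := le_max_left _ _
  generalize max 0 (2 * Real.log (4 / ε)) = c at hc hlog hc0
  have hn0 : (0 : ℝ) < n := by exact_mod_cast hn
  have hl1 : c / n ≤ 1 := (div_le_one hn0).mpr hc
  have hpow : (1 - c / n / 2) ^ n ≤ ε / 4 := by
    calc (1 - c / n / 2) ^ n ≤ Real.exp (-(c / n / 2)) ^ n :=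
          pow_le_pow_left₀ (by linarith) (Real.one_sub_le_exp_neg _) n
      _ = Real.exp (-(c / 2)) := by
          rw [← Real.exp_nat_mul]
          congr 1
          field_simp
      _ ≤ Real.exp (Real.log (ε / 4)) := by
          rw [← inv_div ε 4, Real.log_inv] at hlog
          gcongr
          linarith
      _ = ε / 4 := Real.exp_log (by positivity)
  linarith [robustness_noise_czState_le (n := n) (div_nonneg hc0 hn0.le) hl1]

theorem threshold_isBigO {ε : ℝ} (hε : 0 < ε) :
    (fun n : ℕ => threshold ε (czState n)) =O[atTop] fun n : ℕ => 1 / (n : ℝ) := by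
  obtain ⟨c, hc0, hc⟩ := exists_forall_robustness_le hε
  refine IsBigO.of_bound c ?_
  filter_upwards [eventually_ge_atTop 1, eventually_ge_atTop ⌈c⌉₊] with n hn hcn
  have hcn : c ≤ n := Nat.ceil_le.mp hcn
  have hn0 : (0 : ℝ) < n := by exact_mod_cast hn
  rw [Real.norm_of_nonneg (threshold_nonneg _ _), Real.norm_of_nonneg (by positivity), mul_one_div]
  exact csInf_le ⟨0, fun _ hl => hl.1.1⟩
    ⟨⟨div_nonneg hc0 hn0.le, (div_le_one hn0).mpr hcn⟩, hc n hn hcn⟩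

/-- If the noiseless robustness stays above a level `b > 1 + ε`, then noise of rate at most `d / n`
with a small constant `d` keeps it above `1 + ε`. -/
theorem one_div_isBigO_threshold {ε b : ℝ} (hε : 0 < ε) (hb : 1 + ε < b)
    (h : ∀ᶠ n : ℕ in atTop, b ≤ robustness (czState n)) :
    (fun n : ℕ => 1 / (n : ℝ)) =O[atTop] fun n : ℕ => threshold ε (czState n) := by
  obtain ⟨c, hc0, hc⟩ := exists_forall_robustness_le hε
  have hb0 : 0 < b := by linarith
  -- `d` is such that `(1 - 3 d / 2) b > 1 + ε`.
  obtain ⟨d, hd, hdb⟩ : ∃ d : ℝ, 0 < d ∧ 1 + ε < (1 - 3 * d / 2) * b := by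
    refine ⟨(b - (1 + ε)) / (3 * b), div_pos (by linarith) (by linarith), ?_⟩
    field_simp
    linarith
  refine IsBigO.of_bound d⁻¹ ?_
  filter_upwards [h, eventually_ge_atTop 1, eventually_ge_atTop ⌈c⌉₊] with n hbn hn hcn
  have hcn : c ≤ n := Nat.ceil_le.mp hcn
  have hn0 : (0 : ℝ) < n := by exact_mod_cast hn
  have hlow : d / n ≤ threshold ε (czState n) := by
    refine le_csInf
      ⟨c / n, ⟨div_nonneg hc0 hn0.le, (div_le_one hn0).mpr hcn⟩, hc n hn hcn⟩ ?_
    rintro l ⟨⟨hl0, hl1⟩, hl⟩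
    by_contra! hlt
    rw [lt_div_iff₀ hn0] at hlt
    have hbern : 1 + (n : ℝ) * (-(3 * l / 4)) ≤ (1 - 3 * l / 4) ^ n := by
      rw [sub_eq_add_neg]
      exact one_add_mul_le_pow (by linarith) n
    have hq : 1 - 3 * d / 2 ≤ 2 * (1 - 3 * l / 4) ^ n - 1 := by linarith
    have hd1 : 0 ≤ 1 - 3 * d / 2 := (pos_of_mul_pos_left (by linarith) hb0.le).le
    have hmul := mul_robustness_le_robustness_noise hl0 hl1 (hasStabDecomp_czState n)
      ⟨_, hasStabDecomp_noise_czState hl0 hl1⟩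
    have hmul2 : (1 - 3 * d / 2) * b ≤
        (2 * (1 - 3 * l / 4) ^ n - 1) * robustness (czState n) :=
      mul_le_mul hq hbn hb0.le (hd1.trans hq)
    linarith
  rw [Real.norm_of_nonneg (threshold_nonneg _ _), Real.norm_of_nonneg (by positivity),
    inv_mul_eq_div, le_div_iff₀ hd]
  calc 1 / (n : ℝ) * d = d / n := by ring
    _ ≤ _ := hlow

/-- The robustness of the noiseless states is at least their Pauli norm, which tends to `3`. -/
theorem eventually_le_robustness_czState {b : ℝ} (hb : b < 3) :
    ∀ᶠ n : ℕ in atTop, b ≤ robustness (czState n) := by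
  have hlim : Tendsto (fun n : ℕ => 3 + 8 * (1 / 4 : ℝ) ^ n - 10 * (1 / 2 : ℝ) ^ n) atTop
      (nhds (3 + 8 * 0 - 10 * 0)) :=
    ((tendsto_pow_atTop_nhds_zero_of_lt_one (by norm_num) (by norm_num)).const_mul 8
      |>.const_add 3).sub
      ((tendsto_pow_atTop_nhds_zero_of_lt_one (by norm_num) (by norm_num)).const_mul 10)
  filter_upwards [hlim.eventually_const_lt (by linarith : b < 3 + 8 * 0 - 10 * 0),
    eventually_ge_atTop 2] with n hn h2
  have h := pauliNorm_noise_czState h2 (zero_le_one (α := ℝ))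
  rw [noise_zero] at h
  have hle := pauliNorm_le_robustness (hasStabDecomp_czState n)
  rw [h] at hle
  refine hn.le.trans (le_trans (le_of_eq ?_) hle)
  simp only [mul_zero, zero_div, sub_zero, one_pow, _root_.one_div_pow]
  ring

end QMagic

theorem theorem1 :
    -- for every fixed `ε ∈ (0, 2)` the threshold is `Θ(1/n)`
    (∀ ε : ℝ, 0 < ε → ε < 2 →
      (fun n : ℕ => threshold ε (czState n)) =Θ[atTop] fun n : ℕ => 1 / (n : ℝ)) ∧
    -- more generally, so it is as long as the noiseless states lie above the level `1 + ε`
    (∀ ε : ℝ, 0 < ε → 1 + ε < liminf (fun n : ℕ => robustness (czState n)) atTop →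
      (fun n : ℕ => threshold ε (czState n)) =Θ[atTop] fun n : ℕ => 1 / (n : ℝ)) ∧
    -- the upper bound `O(1/n)` holds for every `ε > 0`
    (∀ ε : ℝ, 0 < ε →
      (fun n : ℕ => threshold ε (czState n)) =O[atTop] fun n : ℕ => 1 / (n : ℝ)) ∧
    -- the bounds for the noisy states
    (∀ n : ℕ, 1 ≤ n → ∀ l : ℝ, 0 ≤ l → l ≤ 1 →
      pauliNorm (noise n l (czState n)) ≤ robustness (noise n l (czState n)) ∧
      robustness (noise n l (czState n)) ≤ 1 + 4 * (1 - l / 2) ^ n) ∧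
    (∀ n : ℕ, 2 ≤ n → ∀ l : ℝ, 0 ≤ l → l ≤ 1 →
      pauliNorm (noise n l (czState n)) =
        2 * (1 - 3 * l / 4) ^ n + (1 - l / 2) ^ n + 8 / 4 ^ n - 10 * (1 / 2 - l / 4) ^ n) := by
  refine ⟨fun ε h0 h2 => ?_, fun ε h0 h => ?_, fun ε h0 => threshold_isBigO h0,
    fun n _ l h0 h1 => ⟨pauliNorm_le_robustness ⟨_, hasStabDecomp_noise_czState h0 h1⟩,
      robustness_noise_czState_le h0 h1⟩,
    fun n hn l _ h1 => pauliNorm_noise_czState hn h1⟩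
  · obtain ⟨b, hb, hb3⟩ := exists_between (by linarith : 1 + ε < 3)
    exact ⟨threshold_isBigO h0,
      one_div_isBigO_threshold h0 hb (eventually_le_robustness_czState hb3)⟩
  · obtain ⟨b, hb, hbl⟩ := exists_between h
    -- A level below the liminf is eventually exceeded because the robustness is bounded below.
    have hbdd : IsBoundedUnder (· ≥ ·) atTop fun n : ℕ => robustness (czState n) :=
      isBoundedUnder_of ⟨0, fun n => robustness_nonneg (czState n)⟩
    exact ⟨threshold_isBigO h0, one_div_isBigO_threshold h0 hb
      ((eventually_lt_of_lt_liminf hbl hbdd).mono fun _ => le_of_lt)⟩
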